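/- For a number field $K$ with ring of integers $\mathcal{O}_K$, and for a prime $p$ and an integer $f \ge 1$, let $\Pi_{p^f}(K)$ be the product of all maximal ideals of $\mathcal{O}_K$ of norm $p^f$ (the unit ideal if there are none). The Pólya group $Po(K)$ is the subgroup of the ideal class group of $K$ generated by the classes of all the ideals $\Pi_{p^f}(K)$, and $K$ is a Pólya field if all the $\Pi_{p^f}(K)$ are principal, i.e. if $Po(K)$ is trivial. Below, $\left(\frac{a}{p}\right)$ denotes the Legendre symbol. Let $p_1, p_2, p_3, q_1, q_2$ be distinct prime numbers with $p_1 \equiv p_2 \equiv q_1 \equiv q_2 \equiv 3 \pmod 4$ and $p_3 \equiv 1 \pmod 4$, such that $q_1q_2 \equiv p_1p_2p_3 \equiv 1 \pmod 8$, and let $K = \mathbb{Q}(\sqrt{q_1q_2}, \sqrt{p_1p_2p_3})$. Then $K$ is a Pólya field in each of the following cases. 1. $\left(\frac{p_1}{p_2}\right) = 1$, $\left(\frac{p_1}{p_3}\right) = 1$, $\left(\frac{p_2}{p_3}\right) = -1$, $\left(\frac{p_3}{q_1}\right) = \left(\frac{p_3}{q_2}\right) = \left(\frac{p_1}{q_1}\right)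 = \left(\frac{p_1}{q_2}\right) = -1$ and $\left(\frac{q_1q_2}{p_2}\right) = -1$. 2. $\left(\frac{p_1}{p_2}\right) = 1$, $\left(\frac{p_1}{p_3}\right) = -1$, $\left(\frac{p_2}{p_3}\right) = 1$, $\left(\frac{p_3}{q_1}\right) = \left(\frac{p_3}{q_2}\right) = -\left(\frac{p_1}{q_1}\right) = -\left(\frac{p_1}{q_2}\right) = -1$ and $\left(\frac{q_1q_2}{p_2}\right) = -1$. 3. $\left(\frac{p_1}{p_3}\right) = -1$, $\left(\frac{p_2}{p_3}\right) = -1$, $\left(\frac{p_3}{q_1}\right) = -\left(\frac{p_3}{q_2}\right) = 1$ and $\left(\frac{p_1p_2}{q_1}\right) = \left(\frac{p_1p_2}{q_2}\right) = -\left(\frac{q_1q_2}{p_1}\right) = -1$. 4. $\left(\frac{p_1}{p_2}\right) = -1$, $\left(\frac{p_1}{p_3}\right) = 1$, $\left(\frac{p_2}{p_3}\right) = -1$, $\left(\frac{p_3}{q_1}\right) = \left(\frac{p_3}{q_2}\right) = -1$ and $\left(\frac{p_1p_2}{q_1}\right) = \left(\frac{p_1p_2}{q_2}\right) = -\left(\frac{q_1q_2}{p_1}\right)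 = 1$. 5. $\left(\frac{p_1}{p_2}\right) = -1$, $\left(\frac{p_1}{p_3}\right) = -1$, $\left(\frac{p_2}{p_3}\right) = 1$, $\left(\frac{p_3}{q_1}\right) = \left(\frac{p_3}{q_2}\right) = \left(\frac{p_1}{q_1}\right) = \left(\frac{p_1}{q_2}\right) = -1$ and $\left(\frac{q_1q_2}{p_2}\right) = -1$. Moreover, if $\left(\frac{p_1}{p_3}\right) = \left(\frac{p_2}{p_3}\right) = 1$, then either $K$ is a Pólya field or $Po(K) \simeq \mathbb{Z}/2\mathbb{Z}$. -/

import Mathlib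

open NumberField nonZeroDivisors

noncomputable section

/-- The (finite) set of maximal ideals of `𝓞 K` of absolute norm `q`. -/
def maximalIdealsOfNorm (K : Type*) [Field K] [NumberField K] (q : ℕ) :
    Finset (Ideal (𝓞 K)) :=
  ((Ideal.finite_setOfPred_absNorm_eq (S := 𝓞 K) q).subset
    (fun _ hm => hm.2 : {m : Ideal (𝓞 K) | m.IsMaximal ∧ Ideal.absNorm m = q} ⊆ _)).toFinset

theorem mem_maximalIdealsOfNorm {K : Type*} [Field K] [NumberField K] {q : ℕ}
    {m : Ideal (𝓞 K)} :
    m ∈ maximalIdealsOfNorm K q ↔ m.IsMaximal ∧ Ideal.absNorm m = q := by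
  simp [maximalIdealsOfNorm]

/-- The Ostrowski ideal `Π_q(K)`: the product of all maximal ideals of `𝓞 K` of norm `q`
(the unit ideal if there are none). It is used for prime powers `q = p ^ f`, `f ≥ 1`. -/
def ostrowskiIdeal (K : Type*) [Field K] [NumberField K] (q : ℕ) : Ideal (𝓞 K) :=
  ∏ m ∈ maximalIdealsOfNorm K q, m

theorem ostrowskiIdeal_mem_nonZeroDivisors (K : Type*) [Field K] [NumberField K] (q : ℕ) :
    ostrowskiIdeal K q ∈ (Ideal (𝓞 K))⁰ := by
  rw [mem_nonZeroDivisors_iff_ne_zero, ostrowskiIdeal, Finset.prod_ne_zero_iff]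
  intro m hm h0
  have hmax := (mem_maximalIdealsOfNorm.mp hm).1
  subst h0
  exact RingOfIntegers.not_isField K (Ring.isField_iff_maximal_bot.mpr hmax)

/-- The Pólya group `Po(K)`: the subgroup of the ideal class group generated by the classes of
all Ostrowski ideals `Π_{p^f}(K)`, `p` prime, `f ≥ 1`. -/
def polyaGroup (K : Type*) [Field K] [NumberField K] : Subgroup (ClassGroup (𝓞 K)) :=
  Subgroup.closure {c | ∃ p f : ℕ, p.Prime ∧ 1 ≤ f ∧
    c = ClassGroup.mk0 ⟨ostrowskiIdeal K (p ^ f), ostrowskiIdeal_mem_nonZeroDivisors K (p ^ f)⟩}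

/-- `K` is a Pólya field if all its Ostrowski ideals `Π_{p^f}(K)` are principal. -/
def IsPolyaField (K : Type*) [Field K] [NumberField K] : Prop :=
  ∀ p f : ℕ, p.Prime → 1 ≤ f → (ostrowskiIdeal K (p ^ f)).IsPrincipal

/-- `K` is a Pólya field if and only if its Pólya group is trivial. -/
theorem isPolyaField_iff (K : Type*) [Field K] [NumberField K] :
    IsPolyaField K ↔ polyaGroup K = ⊥ := by
  rw [polyaGroup, Subgroup.closure_eq_bot_iff]
  constructor
  · rintro h c ⟨p, f, hp, hf, rfl⟩
    exact (ClassGroup.mk0_eq_one_iff _).mpr (h p f hp hf)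
  · intro h p f hp hf
    exact (ClassGroup.mk0_eq_one_iff _).mp (h ⟨p, f, hp, hf, rfl⟩)

end

/-! Both radicands are 1 mod 4, so exactly the five given primes ramify in K, each with index 2. For
p unramified the product of the primes above p is (p); for p ramified its square is (p). Hence Po(K)
is generated by five classes of order dividing 2: x₁, x₂, x₃ above the pᵢ and y₁, y₂ above the qⱼ.

Relations come from units. If d has its square root in K, that root gives one relation among the
primes dividing d. Descent on Pell's equation gives another: d = rs with r, s ≠ 1 and ra² - sb² = 1
(`exists_mul_sq_eq_mul_sq_add_one`), and then r is a square in K up to a unit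
(`associated_sq_of_mul_sq_eq`). For d = q₁q₂ this kills y₁ and y₂. For d = p₁p₂p₃, combined with
x₁x₂x₃ = 1, it kills one xᵢ and identifies the other two, so Po(K) has order at most 2.

Which r occurs is constrained by reducing ra² - sb² = 1 modulo the primes dividing d. In the five
cases the symbols at p₃ decide which xᵢ dies. The Pell relation for the product of all five primes
then contains exactly one of the two remaining xᵢ, by a finite check of Legendre symbols, so these
die too. -/

open NumberField nonZeroDivisors

/-! ### Pell descent and its residue conditions. -/

/-- Coprime factors of `d * w ^ 2` are squares up to complementary factors of `d`. -/
theorem Nat.Coprime.exists_eq_mul_sq_of_mul_eq {d u v w : ℕ} (hd : d ≠ 0) (huv : u.Coprime v)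
    (h : u * v = d * w ^ 2) :
    ∃ r s a b : ℕ, r * s = d ∧ u = r * a ^ 2 ∧ v = s * b ^ 2 := by
  have hrs : d.gcd u * d.gcd v = d := by
    rw [← huv.gcd_mul]
    exact Nat.gcd_eq_left ⟨_, h⟩
  obtain ⟨u', hu'⟩ := Nat.gcd_dvd_right d u
  obtain ⟨v', hv'⟩ := Nat.gcd_dvd_right d v
  have hw : u' * v' = w ^ 2 := by
    apply Nat.eq_of_mul_eq_mul_left (Nat.pos_of_ne_zero hd)
    rw [← h]
    conv_lhs => rw [← hrs]
    conv_rhs => rw [hu', hv']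
    ring
  have hcop : IsUnit (gcd u' v') := by
    rw [Nat.isUnit_iff]
    exact huv.coprime_dvd_left ⟨_, by rw [mul_comm]; exact hu'⟩ |>.coprime_dvd_right
      ⟨_, by rw [mul_comm]; exact hv'⟩
  have hcop' : IsUnit (gcd v' u') := by rwa [gcd_comm]
  obtain ⟨a, ha⟩ := exists_eq_pow_of_mul_eq_pow hcop hw
  obtain ⟨b, hb⟩ := exists_eq_pow_of_mul_eq_pow hcop' ((mul_comm _ _).trans hw)
  exact ⟨_, _, a, b, hrs, by rw [← ha]; exact hu', by rw [← hb]; exact hv'⟩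

/-- Descent on the fundamental solution of Pell's equation: a nonsquare `d ≡ 1 mod 4` with a prime
factor `p ≡ 3 mod 4` has a nontrivial factorization `d = r * s` with `r * a ^ 2 - s * b ^ 2 = 1`. -/
theorem exists_mul_sq_eq_mul_sq_add_one {d p : ℕ} (hsq : ¬ IsSquare d) (hd : d % 4 = 1)
    [Fact p.Prime] (hp : p % 4 = 3) (hpd : p ∣ d) :
    ∃ r s a b : ℕ, r * s = d ∧ r ≠ 1 ∧ s ≠ 1 ∧ r * a ^ 2 = s * b ^ 2 + 1 := by
  have hsq' : ¬ IsSquare (d : ℤ) := by rwa [Int.isSquare_natCast_iff]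
  obtain ⟨z, hz⟩ := Pell.IsFundamental.exists_of_not_isSquare (d := (d : ℤ)) (by omega) hsq'
  have hzp := z.prop
  obtain ⟨hx1, hy0, hmin⟩ := hz
  obtain ⟨x, hx⟩ : ∃ x : ℕ, z.x = x := ⟨z.x.toNat, by omega⟩
  obtain ⟨y, hy⟩ : ∃ y : ℕ, z.y = y := ⟨z.y.toNat, by omega⟩
  rw [hx, hy] at hzp
  rw [hx] at hx1
  have hxy : x ^ 2 = d * y ^ 2 + 1 := by zify; linarith
  -- Since d ≡ 1 mod 4, squares modulo 4 force x odd and y even, so (x + 1)/2 and (x - 1)/2 are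
  -- coprime integers with product d(y/2)².
  have h4 : x ^ 2 % 4 = (y ^ 2 + 1) % 4 := by
    rw [hxy, Nat.add_mod, Nat.mul_mod, hd]; simp [Nat.add_mod]
  have hxm : x % 4 = 0 ∨ x % 4 = 1 ∨ x % 4 = 2 ∨ x % 4 = 3 := by omega
  have hym : y % 4 = 0 ∨ y % 4 = 1 ∨ y % 4 = 2 ∨ y % 4 = 3 := by omega
  have hpar : x % 2 = 1 ∧ y % 2 = 0 := by
    rcases hxm with h | h | h | h <;> rcases hym with h' | h' | h' | h' <;>
      simp [Nat.pow_mod, Nat.add_mod, h, h'] at h4 <;> omega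
  obtain ⟨v, rfl⟩ : ∃ v, x = 2 * v + 1 := ⟨x / 2, by omega⟩
  obtain ⟨w, rfl⟩ : ∃ w, y = 2 * w := ⟨y / 2, by omega⟩
  have huv : (v + 1) * v = d * w ^ 2 := by nlinarith
  obtain ⟨r, s, a, b, hrs, hu, hv⟩ := Nat.Coprime.exists_eq_mul_sq_of_mul_eq (by omega)
    (by simp : (v + 1).Coprime v) huv
  have hab : r * a ^ 2 = s * b ^ 2 + 1 := by rw [← hu, ← hv]
  refine ⟨r, s, a, b, hrs, ?_, ?_, hab⟩
  -- If r = 1, then (a, b) solves the same Pell equation with a² = (x + 1)/2, so a < x, against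
  -- minimality.
  · rintro rfl
    obtain rfl : s = d := by simpa using hrs
    have hab' : (a : ℤ) ^ 2 - s * (b : ℤ) ^ 2 = 1 := by zify at hab; linarith
    have ha : 1 < (a : ℤ) := by
      have : 1 < a := by
        by_contra hcon
        have : a ^ 2 ≤ 1 := by nlinarith
        omega
      exact_mod_cast this
    have := hmin (b := Pell.Solution₁.mk a b hab') (by simpa using ha)
    rw [hx] at this
    simp only [Pell.Solution₁.x_mk] at this
    have : 2 * v + 1 ≤ a := by exact_mod_cast this
    nlinarith
  -- If s = 1, then b² ≡ -1 modulo p, impossible for p ≡ 3 mod 4.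
  · rintro rfl
    obtain rfl : r = d := by simpa using hrs
    have : ((r * a ^ 2 : ℕ) : ZMod p) = ((1 * b ^ 2 + 1 : ℕ) : ZMod p) := by rw [hab]
    push_cast at this
    rw [(ZMod.natCast_eq_zero_iff r p).mpr hpd] at this
    exact ZMod.mod_four_ne_three_of_sq_eq_neg_one (y := (b : ZMod p))
      (by linear_combination -this) hp

theorem legendreSym_eq_one_of_dvd_right {p r s a b : ℕ} [Fact p.Prime] (hs : p ∣ s)
    (h : r * a ^ 2 = s * b ^ 2 + 1) : legendreSym p r = 1 := by
  have h' : ((r * a ^ 2 : ℕ) : ZMod p) = ((s * b ^ 2 + 1 : ℕ) : ZMod p) := by rw [h]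
  push_cast at h'
  rw [(ZMod.natCast_eq_zero_iff s p).mpr hs, zero_mul, zero_add] at h'
  have hr : ((r : ℤ) : ZMod p) ≠ 0 := by
    push_cast; intro h0; simp [h0] at h'
  refine legendreSym.eq_one_of_sq_sub_mul_sq_eq_zero' (x := (1 : ZMod p)) (y := a) hr one_ne_zero ?_
  push_cast
  linear_combination -h'

theorem legendreSym_neg_eq_one_of_dvd_left {p r s a b : ℕ} [Fact p.Prime] (hr : p ∣ r)
    (h : r * a ^ 2 = s * b ^ 2 + 1) : legendreSym p (-s) = 1 := by
  have h' : ((r * a ^ 2 : ℕ) : ZMod p) = ((s * b ^ 2 + 1 : ℕ) : ZMod p) := by rw [h]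
  push_cast at h'
  rw [(ZMod.natCast_eq_zero_iff r p).mpr hr, zero_mul] at h'
  have hs : ((-s : ℤ) : ZMod p) ≠ 0 := by
    push_cast; intro h0; simp [neg_eq_zero.mp h0] at h'
  refine legendreSym.eq_one_of_sq_sub_mul_sq_eq_zero' (x := (1 : ZMod p)) (y := b) hs one_ne_zero ?_
  push_cast
  linear_combination -h'

/-! ### Primes above p in a Galois field. -/

section RationalPrimes

/-- The product of the prime ideals of `𝓞 K` above `p`. -/
noncomputable def prodPrimesOver (K : Type*) [Field K] (p : ℕ) : Ideal (𝓞 K) :=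
  ∏ᶠ P ∈ (Ideal.span {(p : ℤ)}).primesOver (𝓞 K), P

variable {K : Type*} [Field K] {p : ℕ}

theorem span_natCast_ne_bot (hp : p.Prime) : Ideal.span {(p : ℤ)} ≠ ⊥ := by
  simpa using hp.ne_zero

theorem isMaximal_span_natCast (hp : p.Prime) : (Ideal.span {(p : ℤ)}).IsMaximal :=
  ((Ideal.span_singleton_prime (by exact_mod_cast hp.ne_zero)).mpr
    (Nat.prime_iff_prime_int.mp hp)).isMaximal (span_natCast_ne_bot hp)

theorem prodPrimesOver_eq_prod [Fintype ((Ideal.span {(p : ℤ)}).primesOver (𝓞 K))] :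
    prodPrimesOver K p = ∏ P ∈ (Ideal.span {(p : ℤ)}).primesOver (𝓞 K), P :=
  finprod_mem_eq_toFinset_prod _ _

variable [NumberField K]

theorem mem_primesOver_of_absNorm_eq_pow {P : Ideal (𝓞 K)} {f : ℕ} (hp : p.Prime)
    (hP : P.IsMaximal) (h : P.absNorm = p ^ f) :
    P ∈ (Ideal.span {(p : ℤ)}).primesOver (𝓞 K) := by
  have := isMaximal_span_natCast hp
  refine ⟨hP.isPrime, ⟨this.eq_of_le (Ideal.IsPrime.under ℤ P).ne_top ?_⟩⟩
  rw [Ideal.span_singleton_le_iff_mem, Ideal.mem_comap]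
  apply hP.isPrime.mem_of_pow_mem f
  have := Ideal.absNorm_mem P
  rw [h] at this
  simpa using this

theorem span_eq_prodPrimesOver_pow [IsGalois ℚ K] (hp : p.Prime) :
    Ideal.span {(p : 𝓞 K)} =
      prodPrimesOver K p ^ (Ideal.span {(p : ℤ)}).ramificationIdxIn (𝓞 K) := by
  have := isMaximal_span_natCast hp
  have h := Ideal.map_algebraMap_eq_finsetProd_pow (R := 𝓞 K) (span_natCast_ne_bot hp)
  rw [Ideal.map_span, Set.image_singleton] at h
  have hcast : algebraMap ℤ (𝓞 K) p = p := by simp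
  rw [hcast] at h
  rw [h, prodPrimesOver_eq_prod, ← Finset.prod_pow]
  refine Finset.prod_congr rfl fun P hP => ?_
  rw [Set.mem_toFinset] at hP
  have := hP.1
  have := hP.2
  rw [Ideal.ramificationIdxIn_eq_ramificationIdx (Ideal.span {(p : ℤ)}) P Gal(K/ℚ)]

theorem absNorm_of_mem_primesOver [IsGalois ℚ K] (hp : p.Prime) {P : Ideal (𝓞 K)}
    (hP : P ∈ (Ideal.span {(p : ℤ)}).primesOver (𝓞 K)) :
    P.absNorm = p ^ (Ideal.span {(p : ℤ)}).inertiaDegIn (𝓞 K) := by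
  have := isMaximal_span_natCast hp
  have := hP.1
  have := hP.2
  have : P.IsMaximal := Ideal.IsMaximal.of_liesOver_isMaximal P (Ideal.span {(p : ℤ)})
  rw [Ideal.absNorm_eq_pow_inertiaDeg' P hp, Ideal.inertiaDeg'_eq_inertiaDeg,
    Ideal.inertiaDegIn_eq_inertiaDeg (Ideal.span {(p : ℤ)}) P Gal(K/ℚ)]

/-- In a Galois extension all primes above p have the same norm, so a given power of p collects
either all of them or none. -/
theorem ostrowskiIdeal_eq_one_or [IsGalois ℚ K] (hp : p.Prime) (f : ℕ) :
    ostrowskiIdeal K (p ^ f) = 1 ∨ ostrowskiIdeal K (p ^ f) = prodPrimesOver K p := by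
  by_cases hf : (Ideal.span {(p : ℤ)}).inertiaDegIn (𝓞 K) = f
  · right
    have := isMaximal_span_natCast hp
    rw [prodPrimesOver_eq_prod]
    refine Finset.prod_congr ?_ fun _ _ => rfl
    ext P
    rw [mem_maximalIdealsOfNorm, Set.mem_toFinset]
    refine ⟨fun h => mem_primesOver_of_absNorm_eq_pow hp h.1 h.2, fun h => ⟨?_, ?_⟩⟩
    · have := h.1
      have := h.2
      exact Ideal.IsMaximal.of_liesOver_isMaximal P (Ideal.span {(p : ℤ)})
    · rw [absNorm_of_mem_primesOver hp h, hf]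
  · left
    refine Finset.prod_eq_one fun P hP => ?_
    rw [mem_maximalIdealsOfNorm] at hP
    have h := absNorm_of_mem_primesOver hp (mem_primesOver_of_absNorm_eq_pow hp hP.1 hP.2)
    rw [hP.2] at h
    exact absurd (Nat.pow_right_injective hp.two_le h).symm hf

theorem squarefree_prodPrimesOver (hp : p.Prime) : Squarefree (prodPrimesOver K p) := by
  have := isMaximal_span_natCast hp
  have hmax : ∀ P ∈ (Ideal.span {(p : ℤ)}).primesOver (𝓞 K), P.IsMaximal := fun P h => by
    have := h.1
    have := h.2
    exact Ideal.IsMaximal.of_liesOver_isMaximal P (Ideal.span {(p : ℤ)})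
  rw [prodPrimesOver_eq_prod]
  refine Finset.squarefree_prod_of_pairwise_isCoprime (fun P hP Q hQ hPQ => ?_) fun P hP => ?_
  · rw [Finset.mem_coe, Set.mem_toFinset] at hP hQ
    have := hmax P hP
    have := hmax Q hQ
    exact (Ideal.isCoprime_of_isMaximal hPQ).isRelPrime
  · rw [Set.mem_toFinset] at hP
    exact ((Ideal.prime_iff_isPrime (Ideal.ne_bot_of_mem_primesOver (span_natCast_ne_bot hp)
      hP)).mpr hP.1).irreducible.squarefree

theorem exists_mem_primesOver (hp : p.Prime) :
    ∃ P, P ∈ (Ideal.span {(p : ℤ)}).primesOver (𝓞 K) := by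
  have := isMaximal_span_natCast hp
  obtain ⟨P⟩ := (inferInstance : Nonempty ((Ideal.span {(p : ℤ)}).primesOver (𝓞 K)))
  exact ⟨P.1, P.2⟩

end RationalPrimes

/-! ### Ramification in a biquadratic field. -/

section Biquadratic

variable {K : Type*} [Field K] [NumberField K] {α β : K} {d₁ d₂ : ℕ}

theorem isGalois_of_adjoin_sqrt_pair (hα : α ^ 2 = (d₁ : K)) (hβ : β ^ 2 = (d₂ : K))
    (hK : IntermediateField.adjoin ℚ {α, β} = ⊤) : IsGalois ℚ K := by
  open Polynomial in
  let f : ℚ[X] := (X ^ 2 - C ((d₁ : ℕ) : ℚ)) * (X ^ 2 - C ((d₂ : ℕ) : ℚ))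
  have hmap : f.map (algebraMap ℚ K) = (X - C α) * (X - C (-α)) * ((X - C β) * (X - C (-β))) := by
    simp only [f, Polynomial.map_mul, Polynomial.map_sub, Polynomial.map_pow, map_X, map_C]
    rw [map_natCast (algebraMap ℚ K), map_natCast (algebraMap ℚ K), ← hα, ← hβ]
    simp only [map_neg, map_pow]
    ring
  have : f.IsSplittingField ℚ K := by
    rw [isSplittingField_iff_intermediateField]
    constructor
    · rw [hmap]
      exact ((Splits.X_sub_C _).mul (Splits.X_sub_C _)).mul
        ((Splits.X_sub_C _).mul (Splits.X_sub_C _))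
    · rw [eq_top_iff, ← hK]
      apply IntermediateField.adjoin.mono
      rintro x (rfl | rfl) <;> rw [mem_rootSet'] <;>
        refine ⟨by rw [hmap]; simp [X_sub_C_ne_zero, -map_neg], ?_⟩ <;>
        simp [f, hα, hβ]
  have := Normal.of_isSplittingField (F := ℚ) (E := K) f
  exact {}

theorem algEquiv_apply_eq_or_neg (hα : α ^ 2 = (d₁ : K)) (σ : Gal(K/ℚ)) :
    σ α = α ∨ σ α = -α := by
  rw [← sq_eq_sq_iff_eq_or_eq_neg, ← map_pow, hα, map_natCast]

theorem algEquiv_ext_of_adjoin_pair (hK : IntermediateField.adjoin ℚ {α, β} = ⊤)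
    {σ τ : Gal(K/ℚ)} (h₁ : σ α = τ α) (h₂ : σ β = τ β) : σ = τ := by
  have h := IntermediateField.algHom_ext_of_eq_adjoin ℚ (K := K) hK.symm
    (φ₁ := (σ : K →ₐ[ℚ] K).comp (IntermediateField.val ⊤))
    (φ₂ := (τ : K →ₐ[ℚ] K).comp (IntermediateField.val ⊤)) (by
      rintro x (rfl | rfl)
      exacts [h₁, h₂])
  ext x
  exact DFunLike.congr_fun h (⟨x, trivial⟩ : (⊤ : IntermediateField ℚ K))

/-- If σ negated α, inertia applied to the integer ω = (1 + α)/2 would give σω - ω = -α ∈ P, hence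
d₁ ∈ P and p ∣ d₁. Using ω rather than α makes the argument cover p = 2. -/
theorem inertia_apply_sqrt_eq {p : ℕ} (hα : α ^ 2 = (d₁ : K)) (hd : d₁ % 4 = 1)
    (hpd : ¬ p ∣ d₁) {P : Ideal (𝓞 K)}
    (hP : P ∈ (Ideal.span {(p : ℤ)}).primesOver (𝓞 K)) {σ : Gal(K/ℚ)}
    (hσ : σ ∈ P.inertia Gal(K/ℚ)) : σ α = α := by
  refine (algEquiv_apply_eq_or_neg hα σ).resolve_right fun hneg => hpd ?_
  have hω : IsIntegral ℤ ((1 + α) / 2) := by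
    obtain ⟨m, hm⟩ : ∃ m, d₁ = 4 * m + 1 := ⟨d₁ / 4, by omega⟩
    refine ⟨Polynomial.X ^ 2 - Polynomial.X - Polynomial.C (m : ℤ), by monicity!, ?_⟩
    rw [hm] at hα
    push_cast at hα
    simp
    linear_combination hα / 4
  have hα' : IsIntegral ℤ α := by
    have : α = (1 + α) / 2 + (1 + α) / 2 - 1 := by ring
    rw [this]
    exact (hω.add hω).sub isIntegral_one
  let ω : 𝓞 K := ⟨_, hω⟩
  let a : 𝓞 K := ⟨α, hα'⟩
  have h := hσ ω
  have hval : σ • ω - ω = -a := by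
    apply RingOfIntegers.ext
    change σ ((1 + α) / 2) - (1 + α) / 2 = -α
    rw [map_div₀, map_add, hneg, map_one, map_ofNat]
    ring
  rw [hval] at h
  have h2 : ((d₁ : ℤ) : 𝓞 K) ∈ P := by
    have : ((d₁ : ℤ) : 𝓞 K) = (-a) * (-a) := by
      apply RingOfIntegers.ext
      change algebraMap (𝓞 K) K ((d₁ : ℤ) : 𝓞 K) = (-α) * (-α)
      rw [map_intCast, Int.cast_natCast, ← hα]
      ring
    rw [this]
    exact P.mul_mem_left _ h
  have h3 : (d₁ : ℤ) ∈ Ideal.span {(p : ℤ)} := by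
    rw [hP.2.over, Ideal.under, Ideal.mem_comap]
    simpa using h2
  rw [Ideal.mem_span_singleton] at h3
  exact_mod_cast h3

end Biquadratic

theorem exists_integer_sq_eq_natCast {K : Type*} [Field K] {δ : K} {n : ℕ}
    (h : δ ^ 2 = (n : K)) :
    ∃ c : 𝓞 K, c ^ 2 = (n : 𝓞 K) := by
  have hδ : IsIntegral ℤ δ := IsIntegral.of_pow two_pos (by rw [h]; exact isIntegral_natCast _)
  refine ⟨⟨δ, hδ⟩, RingOfIntegers.coe_injective ?_⟩
  rw [map_natCast, ← h]
  rfl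

section Biquadratic

variable {K : Type*} [Field K] [NumberField K] {α β : K} {d₁ d₂ p : ℕ}

theorem ramificationIdxIn_eq_one_of_not_dvd (hα : α ^ 2 = (d₁ : K)) (hβ : β ^ 2 = (d₂ : K))
    (hK : IntermediateField.adjoin ℚ {α, β} = ⊤) (hd₁ : d₁ % 4 = 1) (hd₂ : d₂ % 4 = 1)
    (hp : p.Prime) (h₁ : ¬ p ∣ d₁) (h₂ : ¬ p ∣ d₂) :
    (Ideal.span {(p : ℤ)}).ramificationIdxIn (𝓞 K) = 1 := by
  have := isGalois_of_adjoin_sqrt_pair hα hβ hK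
  have := isMaximal_span_natCast hp
  obtain ⟨P, hP⟩ := exists_mem_primesOver (K := K) hp
  have := hP.1
  have := hP.2
  rw [← Ideal.card_inertia_eq_ramificationIdxIn (G := Gal(K/ℚ)) (Ideal.span {(p : ℤ)}) P,
    Subgroup.card_eq_one, Subgroup.eq_bot_iff_forall]
  exact fun σ hσ => algEquiv_ext_of_adjoin_pair hK (inertia_apply_sqrt_eq hα hd₁ h₁ hP hσ)
    (inertia_apply_sqrt_eq hβ hd₂ h₂ hP hσ)

/-- Inertia fixes β, so its elements are determined by the sign they give α. -/
theorem ramificationIdxIn_le_two (hα : α ^ 2 = (d₁ : K)) (hβ : β ^ 2 = (d₂ : K))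
    (hK : IntermediateField.adjoin ℚ {α, β} = ⊤) (hd₂ : d₂ % 4 = 1)
    (hp : p.Prime) (h₂ : ¬ p ∣ d₂) :
    (Ideal.span {(p : ℤ)}).ramificationIdxIn (𝓞 K) ≤ 2 := by
  have := isGalois_of_adjoin_sqrt_pair hα hβ hK
  have := isMaximal_span_natCast hp
  obtain ⟨P, hP⟩ := exists_mem_primesOver (K := K) hp
  have := hP.1
  have := hP.2
  rw [← Ideal.card_inertia_eq_ramificationIdxIn (G := Gal(K/ℚ)) (Ideal.span {(p : ℤ)}) P]
  let g : P.inertia Gal(K/ℚ) → ({α, -α} : Set K) :=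
    fun σ => ⟨σ.1 α, algEquiv_apply_eq_or_neg hα σ.1⟩
  have hg : Function.Injective g := fun σ τ h => Subtype.ext <|
    algEquiv_ext_of_adjoin_pair hK (Subtype.ext_iff.mp h)
      ((inertia_apply_sqrt_eq hβ hd₂ h₂ hP σ.2).trans (inertia_apply_sqrt_eq hβ hd₂ h₂ hP τ.2).symm)
  exact (Nat.card_le_card_of_injective g hg).trans <|
    (Set.ncard_insert_le _ _).trans (by rw [Set.ncard_singleton])

theorem span_natCast_ne_one (hp : p.Prime) : Ideal.span {(p : 𝓞 K)} ≠ 1 := by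
  intro h
  have h1 := congrArg Ideal.absNorm h
  rw [Ideal.absNorm_span_natCast, map_one, Nat.pow_eq_one] at h1
  rcases h1 with h1 | h1
  · exact hp.one_lt.ne' h1
  · exact Module.finrank_pos.ne' h1

/-- A prime ramified in `ℚ(√d₁)` but not in `ℚ(√d₂)` is the square of the product of the primes
above it. -/
theorem prodPrimesOver_sq (hα : α ^ 2 = (d₁ : K)) (hβ : β ^ 2 = (d₂ : K))
    (hK : IntermediateField.adjoin ℚ {α, β} = ⊤) (hd₂ : d₂ % 4 = 1) (hsq : Squarefree d₁)
    (hp : p.Prime) (h₁ : p ∣ d₁) (h₂ : ¬ p ∣ d₂) :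
    prodPrimesOver K p ^ 2 = Ideal.span {(p : 𝓞 K)} := by
  have := isGalois_of_adjoin_sqrt_pair hα hβ hK
  have hspan := span_eq_prodPrimesOver_pow (K := K) hp
  have hle := ramificationIdxIn_le_two hα hβ hK hd₂ hp h₂
  generalize (Ideal.span {(p : ℤ)}).ramificationIdxIn (𝓞 K) = e at hspan hle
  have hne0 : e ≠ 0 := by
    rintro rfl
    exact span_natCast_ne_one hp hspan
  -- If e = 1, then (p) is squarefree. But (p)(m) = (√d₁)² with coprime factors makes (p) a square,
  -- hence the unit ideal.
  have hne1 : e ≠ 1 := by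
    rintro rfl
    rw [pow_one] at hspan
    obtain ⟨m, rfl⟩ := h₁
    obtain ⟨a, ha⟩ := exists_integer_sq_eq_natCast hα
    rw [Nat.cast_mul] at ha
    have hmul : Ideal.span {(p : 𝓞 K)} * Ideal.span {(m : 𝓞 K)} = Ideal.span {a} ^ 2 := by
      rw [Ideal.span_singleton_mul_span_singleton, ← ha, Ideal.span_singleton_pow]
    have hcop : IsUnit (gcd (Ideal.span {(p : 𝓞 K)}) (Ideal.span {(m : 𝓞 K)})) := by
      have hpm : p.Coprime m := Nat.coprime_of_squarefree_mul hsq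
      have h := (Nat.isCoprime_iff_coprime.mpr hpm).map (Int.castRingHom (𝓞 K))
      rw [eq_intCast, eq_intCast, Int.cast_natCast, Int.cast_natCast] at h
      rw [gcd_isUnit_iff_isRelPrime]
      exact ((Ideal.isCoprime_span_singleton_iff _ _).mpr h).isRelPrime
    obtain ⟨J, hJ⟩ := exists_eq_pow_of_mul_eq_pow hcop hmul
    have hu : IsUnit J := squarefree_prodPrimesOver (K := K) hp J ⟨1, by rw [← hspan, hJ]; ring⟩
    rw [Ideal.isUnit_iff, ← Ideal.one_eq_top] at hu
    rw [hu, one_pow] at hJ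
    exact span_natCast_ne_one hp hJ
  obtain rfl : e = 2 := by omega
  exact hspan.symm

theorem isPrincipal_of_sq_eq_span_sq {R : Type*} [CommRing R] [IsDedekindDomain R] {J : Ideal R}
    {c r : R} (h : Associated (c ^ 2) r) (hJ : J ^ 2 = Ideal.span {r}) : J.IsPrincipal := by
  have h2 : J ^ 2 = Ideal.span {c} ^ 2 := by
    rw [hJ, Ideal.span_singleton_pow, Ideal.span_singleton_eq_span_singleton.mpr h]
  exact ⟨c, pow_left_injective two_ne_zero h2⟩

/-- If `r * a ^ 2 - s * b ^ 2 = 1`, then `r` is a square up to a unit in any ring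
containing `√(r * s)`. -/
theorem associated_sq_of_mul_sq_eq {R : Type*} [CommRing R] {δ r s a b : R}
    (hδ : δ ^ 2 = r * s) (h : r * a ^ 2 = s * b ^ 2 + 1) :
    Associated ((r * a + b * δ) ^ 2) r := by
  -- The unit is (a√r + b√s)² written with δ = √(rs). Its inverse is its conjugate, their product
  -- being (ra² - sb²)² = 1.
  refine Associated.symm ⟨⟨r * a ^ 2 + s * b ^ 2 + 2 * a * b * δ,
    r * a ^ 2 + s * b ^ 2 - 2 * a * b * δ, ?_, ?_⟩, ?_⟩
  · linear_combination (-4 * a ^ 2 * b ^ 2) * hδ + (r * a ^ 2 - s * b ^ 2 + 1) * h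
  · linear_combination (-4 * a ^ 2 * b ^ 2) * hδ + (r * a ^ 2 - s * b ^ 2 + 1) * h
  · change r * (r * a ^ 2 + s * b ^ 2 + 2 * a * b * δ) = _
    linear_combination (- b ^ 2) * hδ

end Biquadratic

/-! ### Relations between ideal classes of square roots of (n). -/

section Classes

variable (K : Type*) [Field K] [NumberField K]

/-- The ideal class of the product of the primes above `p`. -/
noncomputable def primesOverClass (p : ℕ) [hp : Fact p.Prime] : ClassGroup (𝓞 K) :=
  ClassGroup.mk0 ⟨prodPrimesOver K p,
    mem_nonZeroDivisors_iff_ne_zero.mpr (squarefree_prodPrimesOver hp.out).ne_zero⟩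

variable {K} in
theorem mk0_eq_primesOverClass {p : ℕ} [Fact p.Prime] {I : (Ideal (𝓞 K))⁰}
    (hI : (I : Ideal (𝓞 K)) = prodPrimesOver K p) : ClassGroup.mk0 I = primesOverClass K p :=
  congrArg ClassGroup.mk0 (Subtype.ext hI)

/-- `g` is the class of an ideal whose square is generated by `n`. -/
def IsClassOfSqrt (n : ℕ) (g : ClassGroup (𝓞 K)) : Prop :=
  ∃ J : (Ideal (𝓞 K))⁰, (J : Ideal (𝓞 K)) ^ 2 = Ideal.span {(n : 𝓞 K)} ∧ ClassGroup.mk0 J = g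

variable {K}

theorem IsClassOfSqrt.one : IsClassOfSqrt K 1 1 :=
  ⟨1, by simp [Ideal.one_eq_top], map_one _⟩

theorem IsClassOfSqrt.mul {m n : ℕ} {g h : ClassGroup (𝓞 K)} (hg : IsClassOfSqrt K m g)
    (hh : IsClassOfSqrt K n h) : IsClassOfSqrt K (m * n) (g * h) := by
  obtain ⟨I, hI, rfl⟩ := hg
  obtain ⟨J, hJ, rfl⟩ := hh
  refine ⟨I * J, ?_, map_mul _ _ _⟩
  rw [Submonoid.coe_mul, mul_pow, hI, hJ, Ideal.span_singleton_mul_span_singleton, Nat.cast_mul]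

theorem IsClassOfSqrt.cond {n : ℕ} {g : ClassGroup (𝓞 K)} (hg : IsClassOfSqrt K n g) (e : Bool) :
    IsClassOfSqrt K (bif e then n else 1) (bif e then g else 1) := by
  cases e
  exacts [.one, hg]

/-- Squaring is injective on ideals of a Dedekind domain, so the square root of (n) is (c). -/
theorem IsClassOfSqrt.eq_one {n : ℕ} {g : ClassGroup (𝓞 K)} (hg : IsClassOfSqrt K n g) {c : 𝓞 K}
    (hc : Associated (c ^ 2) (n : 𝓞 K)) : g = 1 := by
  obtain ⟨J, hJ, rfl⟩ := hg
  rw [ClassGroup.mk0_eq_one_iff]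
  exact isPrincipal_of_sq_eq_span_sq hc hJ

theorem IsClassOfSqrt.sq_eq_one {n : ℕ} {g : ClassGroup (𝓞 K)} (hg : IsClassOfSqrt K n g) :
    g * g = 1 :=
  (hg.mul hg).eq_one (c := (n : 𝓞 K)) (by rw [sq, Nat.cast_mul])

theorem isClassOfSqrt_primesOverClass {p : ℕ} [hp : Fact p.Prime]
    (h : prodPrimesOver K p ^ 2 = Ideal.span {(p : 𝓞 K)}) :
    IsClassOfSqrt K p (primesOverClass K p) :=
  ⟨⟨prodPrimesOver K p, mem_nonZeroDivisors_iff_ne_zero.mpr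
    (squarefree_prodPrimesOver hp.out).ne_zero⟩, h, rfl⟩

/-- The class relation attached to a factor `r` with `r * a ^ 2 - s * b ^ 2 = 1`. -/
theorem IsClassOfSqrt.eq_one_of_mul_sq_eq {r s a b : ℕ} {g : ClassGroup (𝓞 K)}
    (hg : IsClassOfSqrt K r g) {δ : K} (hδ : δ ^ 2 = ((r * s : ℕ) : K))
    (h : r * a ^ 2 = s * b ^ 2 + 1) : g = 1 := by
  obtain ⟨c, hc⟩ := exists_integer_sq_eq_natCast hδ
  have h' := congrArg (Nat.cast : ℕ → 𝓞 K) h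
  push_cast at hc h'
  exact hg.eq_one (associated_sq_of_mul_sq_eq hc h')

theorem IsClassOfSqrt.eq_one_of_sqrt {n : ℕ} {g : ClassGroup (𝓞 K)}
    (hg : IsClassOfSqrt K n g) {δ : K} (hδ : δ ^ 2 = (n : K)) : g = 1 := by
  obtain ⟨c, hc⟩ := exists_integer_sq_eq_natCast hδ
  exact hg.eq_one (Associated.of_eq hc)

end Classes

/-! ### Generators of the Pólya group. -/

section Biquadratic

variable {K : Type*} [Field K] [NumberField K] {α β : K} {d₁ d₂ : ℕ}

/-- The Pólya group is generated by the classes of the primes above ramified rational primes. -/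
theorem polyaGroup_le_of_primesOverClass_mem (hα : α ^ 2 = (d₁ : K)) (hβ : β ^ 2 = (d₂ : K))
    (hK : IntermediateField.adjoin ℚ {α, β} = ⊤) (hd₁ : d₁ % 4 = 1) (hd₂ : d₂ % 4 = 1)
    {H : Subgroup (ClassGroup (𝓞 K))}
    (hH : ∀ (p : ℕ) [Fact p.Prime], p ∣ d₁ ∨ p ∣ d₂ → primesOverClass K p ∈ H) :
    polyaGroup K ≤ H := by
  have := isGalois_of_adjoin_sqrt_pair hα hβ hK
  rw [polyaGroup, Subgroup.closure_le]
  rintro c ⟨p, f, hp, -, rfl⟩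
  have : Fact p.Prime := ⟨hp⟩
  have hprin : (ostrowskiIdeal K (p ^ f)).IsPrincipal → ClassGroup.mk0 ⟨ostrowskiIdeal K (p ^ f),
      ostrowskiIdeal_mem_nonZeroDivisors K (p ^ f)⟩ ∈ H := fun h => by
    rw [(ClassGroup.mk0_eq_one_iff _).mpr h]
    exact H.one_mem
  rcases ostrowskiIdeal_eq_one_or (K := K) hp f with h | h
  · apply hprin
    rw [h, Ideal.one_eq_top]
    exact top_isPrincipal
  by_cases hpd : p ∣ d₁ ∨ p ∣ d₂
  · rw [SetLike.mem_coe, mk0_eq_primesOverClass h]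
    exact hH p hpd
  · rw [not_or] at hpd
    apply hprin
    have hspan := span_eq_prodPrimesOver_pow (K := K) hp
    rw [ramificationIdxIn_eq_one_of_not_dvd hα hβ hK hd₁ hd₂ hp hpd.1 hpd.2, pow_one] at hspan
    rw [h, ← hspan]
    exact ⟨_, rfl⟩

end Biquadratic

theorem Subgroup.eq_bot_or_nonempty_mulEquiv_of_le_zpowers {G : Type*} [Group G] {g : G}
    (hg : g * g = 1) {H : Subgroup G} (hH : H ≤ Subgroup.zpowers g) :
    H = ⊥ ∨ Nonempty (H ≃* Multiplicative (ZMod 2)) := by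
  have hdvd : Nat.card H ∣ 2 := by
    refine (Subgroup.card_dvd_of_le hH).trans ?_
    rw [Nat.card_zpowers]
    exact orderOf_dvd_of_pow_eq_one (by rw [sq, hg])
  rcases (Nat.dvd_prime Nat.prime_two).mp hdvd with h | h
  · exact .inl (Subgroup.card_eq_one.mp h)
  · have : Fact (Nat.Prime 2) := ⟨Nat.prime_two⟩
    exact .inr ⟨mulEquivOfPrimeCardEq (p := 2) h (by simp)⟩

/-- The Boolean records whether p is assigned to r or to s. Iterated over the primes of d, it
encodes a factorization d = rs by one bit per prime. -/
theorem exists_cond_of_mul_eq_prime_mul {p n r s : ℕ} (hp : p.Prime) (h : r * s = p * n) :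
    ∃ (e : Bool) (r' s' : ℕ), r = (bif e then p else 1) * r' ∧ s = (bif !e then p else 1) * s' ∧
      r' * s' = n := by
  rcases (hp.dvd_mul).mp ⟨n, h⟩ with ⟨t, rfl⟩ | ⟨t, rfl⟩
  · exact ⟨true, t, s, by simp, by simp,
      Nat.eq_of_mul_eq_mul_left hp.pos (by rw [← h]; ring)⟩
  · exact ⟨false, r, t, by simp, by simp,
      Nat.eq_of_mul_eq_mul_left hp.pos (by rw [← h]; ring)⟩

theorem legendreSym_cond (p : ℕ) [Fact p.Prime] (e : Bool) (n : ℕ) :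
    legendreSym p ((bif e then n else 1 : ℕ) : ℤ) = bif e then legendreSym p n else 1 := by
  cases e <;> simp

/-! ### Pell relations for two, three and five primes. -/

section Relations

/-- Modulo p, either r is a square (p ∣ s) or -s is (p ∣ r); the sign appears because -1 is a
nonresidue. -/
theorem legendreSym_of_three_mod_four {p r s r' s' a b : ℕ} [Fact p.Prime] (hp : p % 4 = 3)
    {e : Bool} (hr : r = (bif e then p else 1) * r') (hs : s = (bif !e then p else 1) * s')
    (h : r * a ^ 2 = s * b ^ 2 + 1) :
    legendreSym p ((bif e then s' else r' : ℕ) : ℤ) = bif e then -1 else 1 := by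
  cases e
  · obtain rfl : r = r' := by simpa using hr
    exact legendreSym_eq_one_of_dvd_right ⟨s', by simpa using hs⟩ h
  · obtain rfl : s = s' := by simpa using hs
    have h1 := legendreSym_neg_eq_one_of_dvd_left ⟨r', by simpa using hr⟩ h
    rw [legendreSym.at_neg (by rintro rfl; omega), ZMod.χ₄_nat_three_mod_four hp] at h1
    simp only [cond_true]
    linarith

theorem legendreSym_of_one_mod_four {p r s r' s' a b : ℕ} [Fact p.Prime] (hp : p % 4 = 1)
    {e : Bool} (hr : r = (bif e then p else 1) * r') (hs : s = (bif !e then p else 1) * s')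
    (h : r * a ^ 2 = s * b ^ 2 + 1) :
    legendreSym p ((bif e then s' else r' : ℕ) : ℤ) = 1 := by
  cases e
  · obtain rfl : r = r' := by simpa using hr
    exact legendreSym_eq_one_of_dvd_right ⟨s', by simpa using hs⟩ h
  · obtain rfl : s = s' := by simpa using hs
    have h1 := legendreSym_neg_eq_one_of_dvd_left ⟨r', by simpa using hr⟩ h
    rw [legendreSym.at_neg (by rintro rfl; omega), ZMod.χ₄_nat_one_mod_four hp] at h1
    simp only [cond_true]
    linarith

variable {K : Type*} [Field K] [NumberField K]

/-- Here r can only be q₁ or q₂, so one class is trivial, and y₁y₂ = 1 handles the other. -/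
theorem classes_eq_one_of_two_primes {q₁ q₂ : ℕ} [h₁ : Fact q₁.Prime] [h₂ : Fact q₂.Prime]
    {y₁ y₂ : ClassGroup (𝓞 K)} (hy₁ : IsClassOfSqrt K q₁ y₁) (hy₂ : IsClassOfSqrt K q₂ y₂)
    (hq₁ : q₁ % 4 = 3) (hmod : q₁ * q₂ % 4 = 1) (hsq : ¬ IsSquare (q₁ * q₂))
    {δ : K} (hδ : δ ^ 2 = ((q₁ * q₂ : ℕ) : K)) : y₁ = 1 ∧ y₂ = 1 := by
  obtain ⟨r, s, a, b, hrs, hr1, hs1, h⟩ :=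
    exists_mul_sq_eq_mul_sq_add_one hsq hmod hq₁ (dvd_mul_right _ _)
  have hprod : y₁ * y₂ = 1 := (hy₁.mul hy₂).eq_one_of_sqrt hδ
  rw [← hrs] at hδ
  have hrs' : r * s = q₁ * (q₂ * 1) := by rw [hrs, mul_one]
  obtain ⟨e₁, r₁, s₁, hr, hs, hrs₁⟩ := exists_cond_of_mul_eq_prime_mul h₁.out hrs'
  obtain ⟨e₂, r₂, s₂, rfl, rfl, hrs₂⟩ := exists_cond_of_mul_eq_prime_mul h₂.out hrs₁
  obtain ⟨rfl, rfl⟩ := mul_eq_one.mp hrs₂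
  have hg : (bif e₁ then y₁ else 1) * ((bif e₂ then y₂ else 1) * 1) = 1 := by
    refine IsClassOfSqrt.eq_one_of_mul_sq_eq ?_ hδ h
    rw [hr]
    exact (hy₁.cond e₁).mul ((hy₂.cond e₂).mul .one)
  cases e₁ <;> cases e₂ <;> simp_all

/-- Only the symbol at p₃ is kept: it suffices to decide which two bits agree in the five cases. -/
theorem exists_class_relation_of_three_primes {p₁ p₂ p₃ : ℕ}
    [h₁ : Fact p₁.Prime] [h₂ : Fact p₂.Prime] [h₃ : Fact p₃.Prime]
    {x₁ x₂ x₃ : ClassGroup (𝓞 K)} (hx₁ : IsClassOfSqrt K p₁ x₁) (hx₂ : IsClassOfSqrt K p₂ x₂)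
    (hx₃ : IsClassOfSqrt K p₃ x₃)
    (hp₁ : p₁ % 4 = 3) (hp₃ : p₃ % 4 = 1) (hmod : p₁ * p₂ * p₃ % 4 = 1)
    (hsq : ¬ IsSquare (p₁ * p₂ * p₃)) {δ : K} (hδ : δ ^ 2 = ((p₁ * p₂ * p₃ : ℕ) : K)) :
    ∃ e₁ e₂ e₃ : Bool, ¬ (e₁ = e₂ ∧ e₂ = e₃) ∧
      (bif e₁ then x₁ else 1) * ((bif e₂ then x₂ else 1) * (bif e₃ then x₃ else 1)) = 1 ∧
      (bif e₃ ^^ e₁ then legendreSym p₃ p₁ else 1) *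
        (bif e₃ ^^ e₂ then legendreSym p₃ p₂ else 1) = 1 := by
  obtain ⟨r, s, a, b, hrs, hr1, hs1, h⟩ :=
    exists_mul_sq_eq_mul_sq_add_one hsq hmod hp₁ ⟨p₂ * p₃, by ring⟩
  rw [← hrs] at hδ
  have hrs' : r * s = p₁ * (p₂ * (p₃ * 1)) := by rw [hrs]; ring
  obtain ⟨e₁, r₁, s₁, hr, hs, hrs₁⟩ := exists_cond_of_mul_eq_prime_mul h₁.out hrs'
  obtain ⟨e₂, r₂, s₂, rfl, rfl, hrs₂⟩ := exists_cond_of_mul_eq_prime_mul h₂.out hrs₁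
  obtain ⟨e₃, r₃, s₃, rfl, rfl, hrs₃⟩ := exists_cond_of_mul_eq_prime_mul h₃.out hrs₂
  obtain ⟨rfl, rfl⟩ := mul_eq_one.mp hrs₃
  refine ⟨e₁, e₂, e₃, ?_, ?_, ?_⟩
  · rintro ⟨rfl, rfl⟩
    cases e₁ <;> simp_all
  · refine IsClassOfSqrt.eq_one_of_mul_sq_eq ?_ hδ h
    rw [hr, mul_one]
    exact (hx₁.cond e₁).mul ((hx₂.cond e₂).mul (hx₃.cond e₃))
  · have h3 := legendreSym_of_one_mod_four hp₃ (hr.trans (by ring :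
      _ = (bif e₃ then p₃ else 1) * ((bif e₁ then p₁ else 1) * (bif e₂ then p₂ else 1))))
      (hs.trans (by ring :
      _ = (bif !e₃ then p₃ else 1) * ((bif !e₁ then p₁ else 1) * (bif !e₂ then p₂ else 1)))) h
    cases e₃ <;>
      simpa only [cond_true, cond_false, Nat.cast_mul, legendreSym.mul, legendreSym_cond,
        Bool.false_xor, Bool.true_xor] using h3

theorem exists_class_relation_of_five_primes {p₁ p₂ p₃ q₁ q₂ : ℕ}
    [h₁ : Fact p₁.Prime] [h₂ : Fact p₂.Prime] [h₃ : Fact p₃.Prime] [h₄ : Fact q₁.Prime]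
    [h₅ : Fact q₂.Prime] {x₁ x₂ x₃ y₁ y₂ : ClassGroup (𝓞 K)}
    (hx₁ : IsClassOfSqrt K p₁ x₁) (hx₂ : IsClassOfSqrt K p₂ x₂) (hx₃ : IsClassOfSqrt K p₃ x₃)
    (hy₁ : IsClassOfSqrt K q₁ y₁) (hy₂ : IsClassOfSqrt K q₂ y₂)
    (hp₁ : p₁ % 4 = 3) (hp₂ : p₂ % 4 = 3) (hp₃ : p₃ % 4 = 1) (hq₁ : q₁ % 4 = 3) (hq₂ : q₂ % 4 = 3)
    (hmod : q₁ * q₂ * (p₁ * p₂ * p₃) % 4 = 1) (hsq : ¬ IsSquare (q₁ * q₂ * (p₁ * p₂ * p₃)))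
    {δ : K} (hδ : δ ^ 2 = ((q₁ * q₂ * (p₁ * p₂ * p₃) : ℕ) : K)) :
    ∃ e₁ e₂ e₃ f₁ f₂ : Bool, ¬ (e₁ = e₂ ∧ e₂ = e₃ ∧ e₃ = f₁ ∧ f₁ = f₂) ∧
      (bif e₁ then x₁ else 1) * ((bif e₂ then x₂ else 1) * ((bif e₃ then x₃ else 1) *
        ((bif f₁ then y₁ else 1) * (bif f₂ then y₂ else 1)))) = 1 ∧
      (bif e₁ ^^ e₂ then legendreSym p₁ p₂ else 1) * ((bif e₁ ^^ e₃ then legendreSym p₁ p₃ else 1) *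
        ((bif e₁ ^^ f₁ then legendreSym p₁ q₁ else 1) *
          (bif e₁ ^^ f₂ then legendreSym p₁ q₂ else 1))) = (bif e₁ then -1 else 1) ∧
      (bif e₂ ^^ e₁ then legendreSym p₂ p₁ else 1) * ((bif e₂ ^^ e₃ then legendreSym p₂ p₃ else 1) *
        ((bif e₂ ^^ f₁ then legendreSym p₂ q₁ else 1) *
          (bif e₂ ^^ f₂ then legendreSym p₂ q₂ else 1))) = (bif e₂ then -1 else 1) ∧
      (bif e₃ ^^ e₁ then legendreSym p₃ p₁ else 1) * ((bif e₃ ^^ e₂ then legendreSym p₃ p₂ else 1) *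
        ((bif e₃ ^^ f₁ then legendreSym p₃ q₁ else 1) *
          (bif e₃ ^^ f₂ then legendreSym p₃ q₂ else 1))) = 1 ∧
      (bif f₁ ^^ e₁ then legendreSym q₁ p₁ else 1) * ((bif f₁ ^^ e₂ then legendreSym q₁ p₂ else 1) *
        ((bif f₁ ^^ e₃ then legendreSym q₁ p₃ else 1) *
          (bif f₁ ^^ f₂ then legendreSym q₁ q₂ else 1))) = (bif f₁ then -1 else 1) ∧
      (bif f₂ ^^ e₁ then legendreSym q₂ p₁ else 1) * ((bif f₂ ^^ e₂ then legendreSym q₂ p₂ else 1) *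
        ((bif f₂ ^^ e₃ then legendreSym q₂ p₃ else 1) *
          (bif f₂ ^^ f₁ then legendreSym q₂ q₁ else 1))) = (bif f₂ then -1 else 1) := by
  obtain ⟨r, s, a, b, hrs, hr1, hs1, h⟩ :=
    exists_mul_sq_eq_mul_sq_add_one hsq hmod hq₁ ⟨q₂ * (p₁ * p₂ * p₃), by ring⟩
  rw [← hrs] at hδ
  have hrs' : r * s = p₁ * (p₂ * (p₃ * (q₁ * (q₂ * 1)))) := by rw [hrs]; ring
  obtain ⟨e₁, r₁, s₁, hr, hs, hrs₁⟩ := exists_cond_of_mul_eq_prime_mul h₁.out hrs'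
  obtain ⟨e₂, r₂, s₂, rfl, rfl, hrs₂⟩ := exists_cond_of_mul_eq_prime_mul h₂.out hrs₁
  obtain ⟨e₃, r₃, s₃, rfl, rfl, hrs₃⟩ := exists_cond_of_mul_eq_prime_mul h₃.out hrs₂
  obtain ⟨f₁, r₄, s₄, rfl, rfl, hrs₄⟩ := exists_cond_of_mul_eq_prime_mul h₄.out hrs₃
  obtain ⟨f₂, r₅, s₅, rfl, rfl, hrs₅⟩ := exists_cond_of_mul_eq_prime_mul h₅.out hrs₄
  obtain ⟨rfl, rfl⟩ := mul_eq_one.mp hrs₅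
  rw [mul_one] at hr hs
  refine ⟨e₁, e₂, e₃, f₁, f₂, ?_, ?_, ?_, ?_, ?_, ?_, ?_⟩
  · rintro ⟨rfl, rfl, rfl, rfl⟩
    cases e₁ <;> simp_all
  · refine IsClassOfSqrt.eq_one_of_mul_sq_eq ?_ hδ h
    rw [hr]
    exact (hx₁.cond e₁).mul ((hx₂.cond e₂).mul ((hx₃.cond e₃).mul ((hy₁.cond f₁).mul (hy₂.cond f₂))))
  · have h3 := legendreSym_of_three_mod_four hp₁ hr hs h
    cases e₁ <;>
      simpa only [cond_true, cond_false, Nat.cast_mul, legendreSym.mul, legendreSym_cond,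
        Bool.false_xor, Bool.true_xor] using h3
  · have h3 := legendreSym_of_three_mod_four hp₂ (hr.trans (mul_left_comm _ _ _))
      (hs.trans (mul_left_comm _ _ _)) h
    cases e₂ <;>
      simpa only [cond_true, cond_false, Nat.cast_mul, legendreSym.mul, legendreSym_cond,
        Bool.false_xor, Bool.true_xor] using h3
  · have h3 := legendreSym_of_one_mod_four hp₃ (hr.trans (by ring :
      _ = (bif e₃ then p₃ else 1) * ((bif e₁ then p₁ else 1) * ((bif e₂ then p₂ else 1) *
        ((bif f₁ then q₁ else 1) * (bif f₂ then q₂ else 1))))))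
      (hs.trans (by ring :
      _ = (bif !e₃ then p₃ else 1) * ((bif !e₁ then p₁ else 1) * ((bif !e₂ then p₂ else 1) *
        ((bif !f₁ then q₁ else 1) * (bif !f₂ then q₂ else 1)))))) h
    cases e₃ <;>
      simpa only [cond_true, cond_false, Nat.cast_mul, legendreSym.mul, legendreSym_cond,
        Bool.false_xor, Bool.true_xor] using h3
  · have h3 := legendreSym_of_three_mod_four hq₁ (hr.trans (by ring :
      _ = (bif f₁ then q₁ else 1) * ((bif e₁ then p₁ else 1) * ((bif e₂ then p₂ else 1) *
        ((bif e₃ then p₃ else 1) * (bif f₂ then q₂ else 1))))))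
      (hs.trans (by ring :
      _ = (bif !f₁ then q₁ else 1) * ((bif !e₁ then p₁ else 1) * ((bif !e₂ then p₂ else 1) *
        ((bif !e₃ then p₃ else 1) * (bif !f₂ then q₂ else 1)))))) h
    cases f₁ <;>
      simpa only [cond_true, cond_false, Nat.cast_mul, legendreSym.mul, legendreSym_cond,
        Bool.false_xor, Bool.true_xor] using h3
  · have h3 := legendreSym_of_three_mod_four hq₂ (hr.trans (by ring :
      _ = (bif f₂ then q₂ else 1) * ((bif e₁ then p₁ else 1) * ((bif e₂ then p₂ else 1) *
        ((bif e₃ then p₃ else 1) * (bif f₁ then q₁ else 1))))))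
      (hs.trans (by ring :
      _ = (bif !f₂ then q₂ else 1) * ((bif !e₁ then p₁ else 1) * ((bif !e₂ then p₂ else 1) *
        ((bif !e₃ then p₃ else 1) * (bif !f₁ then q₁ else 1)))))) h
    cases f₂ <;>
      simpa only [cond_true, cond_false, Nat.cast_mul, legendreSym.mul, legendreSym_cond,
        Bool.false_xor, Bool.true_xor] using h3

end Relations

/-! ### Elimination of the classes and the main theorem. -/

theorem Squarefree.not_isSquare_of_ne_one {n : ℕ} (h : Squarefree n) (h1 : n ≠ 1) :
    ¬ IsSquare n := by
  rintro ⟨m, rfl⟩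
  have := Nat.isUnit_iff.mp (h m dvd_rfl)
  subst this
  exact h1 rfl

theorem legendreSym_eq_one_or_neg_one_of_prime {p q : ℕ} [Fact p.Prime] [Fact q.Prime]
    (h : p ≠ q) : legendreSym p q = 1 ∨ legendreSym p q = -1 :=
  legendreSym.eq_one_or_neg_one p (by exact_mod_cast ZMod.prime_ne_zero p q h)

/-- With x₁ = 1 the other two classes coincide, so a relation containing exactly one of them kills
both. -/
theorem eq_one_of_eq_one_of_cond_mul_cond_eq_one {G : Type*} [CommGroup G] {x₁ x₂ x₃ : G}
    (hx : x₂ * x₂ = 1) (h : x₁ * x₂ * x₃ = 1) (h₁ : x₁ = 1) {e₁ e₂ e₃ : Bool} (he : e₂ ≠ e₃)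
    (hex : (bif e₁ then x₁ else 1) * ((bif e₂ then x₂ else 1) * (bif e₃ then x₃ else 1)) = 1) :
    x₂ = 1 ∧ x₃ = 1 := by
  subst h₁
  rw [one_mul] at h
  obtain rfl : x₂ = x₃ := mul_left_cancel (hx.trans h.symm)
  cases e₁ <;> cases e₂ <;> cases e₃ <;> simp_all

/-- Two of the three bits agree; the relation, or its complement under x₁x₂x₃ = 1, is the class of
the odd one out. -/
theorem eq_one_of_cond_mul_cond_eq_one {G : Type*} [CommGroup G] {x₁ x₂ x₃ : G}
    (h : x₁ * x₂ * x₃ = 1) {e₁ e₂ e₃ : Bool} (he : ¬ (e₁ = e₂ ∧ e₂ = e₃))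
    (hex : (bif e₁ then x₁ else 1) * ((bif e₂ then x₂ else 1) * (bif e₃ then x₃ else 1)) = 1) :
    (e₂ = e₃ → x₁ = 1) ∧ (e₁ = e₃ → x₂ = 1) ∧ (e₁ = e₂ → x₃ = 1) := by
  have h' : x₁ * x₃ * x₂ = 1 := by rw [mul_right_comm, h]
  have h'' : x₁ * (x₂ * x₃) = 1 := by rw [← mul_assoc, h]
  refine ⟨?_, ?_, ?_⟩ <;> rintro rfl
  · cases e₁ <;> cases e₂ <;> simp_all
  · cases e₁ <;> cases e₂ <;> simp_all
  · cases e₁ <;> cases e₃ <;> simp_all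

theorem theorem1 (p₁ p₂ p₃ q₁ q₂ : ℕ)
    [Fact p₁.Prime] [Fact p₂.Prime] [Fact p₃.Prime] [Fact q₁.Prime] [Fact q₂.Prime]
    (hdistinct : [p₁, p₂, p₃, q₁, q₂].Nodup)
    (hp₁ : p₁ ≡ 3 [MOD 4]) (hp₂ : p₂ ≡ 3 [MOD 4])
    (hq₁ : q₁ ≡ 3 [MOD 4]) (hq₂ : q₂ ≡ 3 [MOD 4]) (hp₃ : p₃ ≡ 1 [MOD 4])
    (hq : q₁ * q₂ ≡ 1 [MOD 8]) (hp : p₁ * p₂ * p₃ ≡ 1 [MOD 8])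
    -- `K = ℚ(α, β)` with `α = √(q₁q₂)` and `β = √(p₁p₂p₃)`
    (K : Type*) [Field K] [NumberField K] (α β : K)
    (hα : α ^ 2 = ((q₁ * q₂ : ℕ) : K)) (hβ : β ^ 2 = ((p₁ * p₂ * p₃ : ℕ) : K))
    (hK : IntermediateField.adjoin ℚ {α, β} = ⊤) :
    -- `legendreSym p a` is the Legendre symbol `(a / p)`
    (legendreSym p₂ p₁ = 1 ∧ legendreSym p₃ p₁ = 1 ∧ legendreSym p₃ p₂ = -1 ∧
        legendreSym q₁ p₃ = -1 ∧ legendreSym q₂ p₃ = -1 ∧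
        legendreSym q₁ p₁ = -1 ∧ legendreSym q₂ p₁ = -1 ∧
        legendreSym p₂ (q₁ * q₂) = -1 →
      IsPolyaField K) ∧
    (legendreSym p₂ p₁ = 1 ∧ legendreSym p₃ p₁ = -1 ∧ legendreSym p₃ p₂ = 1 ∧
        legendreSym q₁ p₃ = -1 ∧ legendreSym q₂ p₃ = -1 ∧
        legendreSym q₁ p₁ = 1 ∧ legendreSym q₂ p₁ = 1 ∧
        legendreSym p₂ (q₁ * q₂) = -1 →
      IsPolyaField K) ∧
    (legendreSym p₃ p₁ = -1 ∧ legendreSym p₃ p₂ = -1 ∧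
        legendreSym q₁ p₃ = 1 ∧ legendreSym q₂ p₃ = -1 ∧
        legendreSym q₁ (p₁ * p₂) = -1 ∧ legendreSym q₂ (p₁ * p₂) = -1 ∧
        legendreSym p₁ (q₁ * q₂) = 1 →
      IsPolyaField K) ∧
    (legendreSym p₂ p₁ = -1 ∧ legendreSym p₃ p₁ = 1 ∧ legendreSym p₃ p₂ = -1 ∧
        legendreSym q₁ p₃ = -1 ∧ legendreSym q₂ p₃ = -1 ∧
        legendreSym q₁ (p₁ * p₂) = 1 ∧ legendreSym q₂ (p₁ * p₂) = 1 ∧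
        legendreSym p₁ (q₁ * q₂) = -1 →
      IsPolyaField K) ∧
    (legendreSym p₂ p₁ = -1 ∧ legendreSym p₃ p₁ = -1 ∧ legendreSym p₃ p₂ = 1 ∧
        legendreSym q₁ p₃ = -1 ∧ legendreSym q₂ p₃ = -1 ∧
        legendreSym q₁ p₁ = -1 ∧ legendreSym q₂ p₁ = -1 ∧
        legendreSym p₂ (q₁ * q₂) = -1 →
      IsPolyaField K) ∧
    (legendreSym p₃ p₁ = 1 ∧ legendreSym p₃ p₂ = 1 →
      IsPolyaField K ∨ Nonempty (polyaGroup K ≃* Multiplicative (ZMod 2))) := by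
  simp only [List.nodup_cons, List.mem_cons, List.not_mem_nil, or_false, not_or, not_false_eq_true,
    List.nodup_nil, and_true] at hdistinct
  obtain ⟨⟨h12, h13, h14, h15⟩, ⟨h23, h24, h25⟩, ⟨h34, h35⟩, h45⟩ := hdistinct
  have P₁ : p₁.Prime := Fact.out
  have P₂ : p₂.Prime := Fact.out
  have P₃ : p₃.Prime := Fact.out
  have Q₁ : q₁.Prime := Fact.out
  have Q₂ : q₂.Prime := Fact.out
  have hp₁' : p₁ % 4 = 3 := hp₁
  have hp₂' : p₂ % 4 = 3 := hp₂
  have hp₃' : p₃ % 4 = 1 := hp₃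
  have hq₁' : q₁ % 4 = 3 := hq₁
  have hq₂' : q₂ % 4 = 3 := hq₂
  have hd₁ : q₁ * q₂ % 4 = 1 := by simp [Nat.mul_mod, hq₁', hq₂']
  have hd₂ : p₁ * p₂ * p₃ % 4 = 1 := by simp [Nat.mul_mod, hp₁', hp₂', hp₃']
  have hd₃ : q₁ * q₂ * (p₁ * p₂ * p₃) % 4 = 1 := by rw [Nat.mul_mod, hd₁, hd₂]
  have cop {a b : ℕ} (ha : a.Prime) (hb : b.Prime) (h : a ≠ b) : a.Coprime b :=
    (Nat.coprime_primes ha hb).mpr h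
  have hcop : (q₁ * q₂).Coprime (p₁ * p₂ * p₃) :=
    Nat.Coprime.mul_left
      (((cop Q₁ P₁ (Ne.symm h14)).mul_right (cop Q₁ P₂ (Ne.symm h24))).mul_right
        (cop Q₁ P₃ (Ne.symm h34)))
      (((cop Q₂ P₁ (Ne.symm h15)).mul_right (cop Q₂ P₂ (Ne.symm h25))).mul_right
        (cop Q₂ P₃ (Ne.symm h35)))
  have hsf₁ : Squarefree (q₁ * q₂) :=
    (Nat.squarefree_mul (cop Q₁ Q₂ h45)).mpr ⟨Q₁.squarefree, Q₂.squarefree⟩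
  have hsf₂ : Squarefree (p₁ * p₂ * p₃) :=
    (Nat.squarefree_mul ((cop P₁ P₃ h13).mul_left (cop P₂ P₃ h23))).mpr
      ⟨(Nat.squarefree_mul (cop P₁ P₂ h12)).mpr ⟨P₁.squarefree, P₂.squarefree⟩, P₃.squarefree⟩
  have hne₁ : q₁ * q₂ ≠ 1 := fun h => Q₁.one_lt.ne' (mul_eq_one.mp h).1
  have hne₂ : p₁ * p₂ * p₃ ≠ 1 := fun h => P₃.one_lt.ne' (mul_eq_one.mp h).2
  have hns₁ := hsf₁.not_isSquare_of_ne_one hne₁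
  have hns₂ := hsf₂.not_isSquare_of_ne_one hne₂
  have hns₃ := ((Nat.squarefree_mul hcop).mpr ⟨hsf₁, hsf₂⟩).not_isSquare_of_ne_one
    (fun h => hne₁ (mul_eq_one.mp h).1)
  have hαβ : (α * β) ^ 2 = ((q₁ * q₂ * (p₁ * p₂ * p₃) : ℕ) : K) := by
    rw [mul_pow, hα, hβ, ← Nat.cast_mul]
  have hK' : IntermediateField.adjoin ℚ {β, α} = ⊤ := by rwa [Set.pair_comm]
  have hnot {p : ℕ} (hp : p.Prime) (h₁ : p ∣ q₁ * q₂) (h₂ : p ∣ p₁ * p₂ * p₃) : False :=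
    hp.one_lt.ne' (Nat.eq_one_of_dvd_coprimes hcop h₁ h₂)
  have classα (p : ℕ) [hp : Fact p.Prime] (h : p ∣ q₁ * q₂) :
      IsClassOfSqrt K p (primesOverClass K p) :=
    isClassOfSqrt_primesOverClass
      (prodPrimesOver_sq hα hβ hK hd₂ hsf₁ hp.out h (hnot hp.out h))
  have classβ (p : ℕ) [hp : Fact p.Prime] (h : p ∣ p₁ * p₂ * p₃) :
      IsClassOfSqrt K p (primesOverClass K p) :=
    isClassOfSqrt_primesOverClass
      (prodPrimesOver_sq hβ hα hK' hd₁ hsf₂ hp.out h fun h' => hnot hp.out h' h)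
  have hx₁ := classβ p₁ ⟨p₂ * p₃, by ring⟩
  have hx₂ := classβ p₂ ⟨p₁ * p₃, by ring⟩
  have hx₃ := classβ p₃ (dvd_mul_left _ _)
  have hy₁ := classα q₁ (dvd_mul_right _ _)
  have hy₂ := classα q₂ (dvd_mul_left _ _)
  have hle (H : Subgroup (ClassGroup (𝓞 K))) (h₁ : primesOverClass K p₁ ∈ H)
      (h₂ : primesOverClass K p₂ ∈ H) (h₃ : primesOverClass K p₃ ∈ H)
      (h₄ : primesOverClass K q₁ ∈ H) (h₅ : primesOverClass K q₂ ∈ H) : polyaGroup K ≤ H := by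
    refine polyaGroup_le_of_primesOverClass_mem hα hβ hK hd₁ hd₂ fun p hp h => ?_
    have hprime {a b : ℕ} : p ∣ a * b ↔ p ∣ a ∨ p ∣ b := hp.out.dvd_mul
    rw [hprime, hprime, hprime, Nat.prime_dvd_prime_iff_eq hp.out Q₁,
      Nat.prime_dvd_prime_iff_eq hp.out Q₂, Nat.prime_dvd_prime_iff_eq hp.out P₁,
      Nat.prime_dvd_prime_iff_eq hp.out P₂, Nat.prime_dvd_prime_iff_eq hp.out P₃] at h
    rcases h with (rfl | rfl) | ((rfl | rfl) | rfl) <;> assumption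
  obtain ⟨hy₁1, hy₂1⟩ := classes_eq_one_of_two_primes hy₁ hy₂ hq₁' hd₁ hns₁ hα
  have hxxx := ((hx₁.mul hx₂).mul hx₃).eq_one_of_sqrt hβ
  have hxx₁ := hx₁.sq_eq_one
  have hxx₂ := hx₂.sq_eq_one
  obtain ⟨a₁, a₂, a₃, hane, hax, ha⟩ :=
    exists_class_relation_of_three_primes hx₁ hx₂ hx₃ hp₁' hp₃' hd₂ hns₂ hβ
  obtain ⟨e₁, e₂, e₃, f₁, f₂, hene, hex, c₁, c₂, c₃, c₄, c₅⟩ :=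
    exists_class_relation_of_five_primes hx₁ hx₂ hx₃ hy₁ hy₂ hp₁' hp₂' hp₃' hq₁' hq₂' hd₃ hns₃ hαβ
  have odd₁ : p₁ ≠ 2 := by rintro rfl; omega
  have odd₂ : p₂ ≠ 2 := by rintro rfl; omega
  have odd₄ : q₁ ≠ 2 := by rintro rfl; omega
  have odd₅ : q₂ ≠ 2 := by rintro rfl; omega
  -- Reciprocity expresses all symbols, in the constraints and in the goal, through one symbol for
  -- each of the ten pairs of primes.
  rw [legendreSym.quadratic_reciprocity_three_mod_four hp₂' hp₁',
    legendreSym.quadratic_reciprocity_one_mod_four hp₃' odd₁,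
    legendreSym.quadratic_reciprocity_three_mod_four hq₁' hp₁',
    legendreSym.quadratic_reciprocity_three_mod_four hq₂' hp₁'] at c₁
  rw [legendreSym.quadratic_reciprocity_one_mod_four hp₃' odd₂,
    legendreSym.quadratic_reciprocity_three_mod_four hq₁' hp₂',
    legendreSym.quadratic_reciprocity_three_mod_four hq₂' hp₂'] at c₂
  rw [← legendreSym.quadratic_reciprocity_one_mod_four hp₃' odd₄,
    ← legendreSym.quadratic_reciprocity_one_mod_four hp₃' odd₅] at c₃
  rw [legendreSym.quadratic_reciprocity_three_mod_four hq₁' hq₂'] at c₅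
  rw [legendreSym.mul, legendreSym.mul, legendreSym.mul, legendreSym.mul,
    legendreSym.quadratic_reciprocity_three_mod_four hq₁' hp₁',
    legendreSym.quadratic_reciprocity_three_mod_four hq₂' hp₁',
    legendreSym.quadratic_reciprocity_three_mod_four hq₁' hp₂',
    legendreSym.quadratic_reciprocity_three_mod_four hq₂' hp₂']
  rw [hy₁1, hy₂1] at hex
  have l₁ := legendreSym_eq_one_or_neg_one_of_prime (Ne.symm h12)
  have l₂ := legendreSym_eq_one_or_neg_one_of_prime (Ne.symm h14)
  have l₃ := legendreSym_eq_one_or_neg_one_of_prime (Ne.symm h15)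
  have l₄ := legendreSym_eq_one_or_neg_one_of_prime (Ne.symm h24)
  have l₅ := legendreSym_eq_one_or_neg_one_of_prime (Ne.symm h25)
  have l₆ := legendreSym_eq_one_or_neg_one_of_prime h45
  have hpolya (h : primesOverClass K p₁ = 1 ∧ primesOverClass K p₂ = 1 ∧
      primesOverClass K p₃ = 1) : IsPolyaField K := by
    rw [isPolyaField_iff, eq_bot_iff]
    apply hle <;> simp [*]
  -- Only signs and bits matter from here on; abstracting the symbols to bare integers lets `decide`
  -- settle the constraints.
  generalize primesOverClass K p₁ = x₁ at *
  generalize primesOverClass K p₂ = x₂ at *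
  generalize primesOverClass K p₃ = x₃ at *
  generalize legendreSym p₂ p₁ = L₁ at *
  generalize legendreSym p₃ p₁ = L₂ at *
  generalize legendreSym p₃ p₂ = L₃ at *
  generalize legendreSym q₁ p₁ = M₁ at *
  generalize legendreSym q₂ p₁ = M₂ at *
  generalize legendreSym q₁ p₂ = M₃ at *
  generalize legendreSym q₂ p₂ = M₄ at *
  generalize legendreSym q₁ p₃ = M₅ at *
  generalize legendreSym q₂ p₃ = M₆ at *
  generalize legendreSym q₁ q₂ = N at *
  have hax' := eq_one_of_cond_mul_cond_eq_one hxxx hane hax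
  -- The relations are permuted so that whichever class dies first can take the first place.
  have hxxx₂ : x₂ * x₁ * x₃ = 1 := by rw [mul_comm x₂, hxxx]
  have hxxx₃ : x₃ * x₁ * x₂ = 1 := by rw [mul_assoc, mul_comm, hxxx]
  simp only [Bool.cond_self, mul_one] at hex
  have hex₂ := (mul_left_comm _ _ _).trans hex
  have hex₃ := ((mul_left_comm _ _ _).trans (congrArg _ (mul_comm _ _))).trans hex
  refine ⟨?_, ?_, ?_, ?_, ?_, ?_⟩
  · rintro ⟨rfl, rfl, rfl, rfl, rfl, rfl, rfl, hM⟩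
    have hx : x₁ = 1 := hax'.1 (by clear * - ha hane; revert a₁ a₂ a₃; decide)
    -- The case leaves three signs free; `hM` discards the inconsistent choices, and the 32 bit
    -- patterns are then checked against the five residue conditions.
    have he : e₂ ≠ e₃ := by
      clear * - l₄ l₅ l₆ hM hene c₁ c₂ c₃ c₄ c₅
      rcases l₄ with rfl | rfl <;> rcases l₅ with rfl | rfl <;> rcases l₆ with rfl | rfl <;>
        norm_num at hM <;>
        revert e₁ e₂ e₃ f₁ f₂ <;> set_option synthInstance.maxSize 1000 in decide
    have h := eq_one_of_eq_one_of_cond_mul_cond_eq_one hxx₂ hxxx hx he hex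
    exact hpolya ⟨hx, h.1, h.2⟩
  · rintro ⟨rfl, rfl, rfl, rfl, rfl, rfl, rfl, hM⟩
    have hx : x₂ = 1 := hax'.2.1 (by clear * - ha hane; revert a₁ a₂ a₃; decide)
    have he : e₁ ≠ e₃ := by
      clear * - l₄ l₅ l₆ hM hene c₁ c₂ c₃ c₄ c₅
      rcases l₄ with rfl | rfl <;> rcases l₅ with rfl | rfl <;> rcases l₆ with rfl | rfl <;>
        norm_num at hM <;>
        revert e₁ e₂ e₃ f₁ f₂ <;> set_option synthInstance.maxSize 1000 in decide
    have h := eq_one_of_eq_one_of_cond_mul_cond_eq_one hxx₁ hxxx₂ hx he hex₂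
    exact hpolya ⟨h.1, hx, h.2⟩
  · rintro ⟨rfl, rfl, rfl, rfl, hM₁, hM₂, hM₃⟩
    have hx : x₃ = 1 := hax'.2.2 (by clear * - ha hane; revert a₁ a₂ a₃; decide)
    have he : e₁ ≠ e₂ := by
      clear * - l₁ l₂ l₃ l₄ l₅ l₆ hM₁ hM₂ hM₃ hene c₁ c₂ c₃ c₄ c₅
      rcases l₁ with rfl | rfl <;> rcases l₂ with rfl | rfl <;> rcases l₃ with rfl | rfl <;>
        rcases l₄ with rfl | rfl <;> rcases l₅ with rfl | rfl <;> rcases l₆ with rfl | rfl <;>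
        norm_num at hM₁ <;> norm_num at hM₂ <;> norm_num at hM₃ <;>
        revert e₁ e₂ e₃ f₁ f₂ <;> set_option synthInstance.maxSize 1000 in decide
    have h := eq_one_of_eq_one_of_cond_mul_cond_eq_one hxx₁ hxxx₃ hx he hex₃
    exact hpolya ⟨h.1, h.2, hx⟩
  · rintro ⟨rfl, rfl, rfl, rfl, rfl, hM₁, hM₂, hM₃⟩
    have hx : x₁ = 1 := hax'.1 (by clear * - ha hane; revert a₁ a₂ a₃; decide)
    have he : e₂ ≠ e₃ := by
      clear * - l₂ l₃ l₄ l₅ l₆ hM₁ hM₂ hM₃ hene c₁ c₂ c₃ c₄ c₅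
      rcases l₂ with rfl | rfl <;> rcases l₃ with rfl | rfl <;> rcases l₄ with rfl | rfl <;>
        rcases l₅ with rfl | rfl <;> rcases l₆ with rfl | rfl <;>
        norm_num at hM₁ <;> norm_num at hM₂ <;> norm_num at hM₃ <;>
        revert e₁ e₂ e₃ f₁ f₂ <;> set_option synthInstance.maxSize 1000 in decide
    have h := eq_one_of_eq_one_of_cond_mul_cond_eq_one hxx₂ hxxx hx he hex
    exact hpolya ⟨hx, h.1, h.2⟩
  · rintro ⟨rfl, rfl, rfl, rfl, rfl, rfl, rfl, hM⟩
    have hx : x₂ = 1 := hax'.2.1 (by clear * - ha hane; revert a₁ a₂ a₃; decide)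
    have he : e₁ ≠ e₃ := by
      clear * - l₄ l₅ l₆ hM hene c₁ c₂ c₃ c₄ c₅
      rcases l₄ with rfl | rfl <;> rcases l₅ with rfl | rfl <;> rcases l₆ with rfl | rfl <;>
        norm_num at hM <;>
        revert e₁ e₂ e₃ f₁ f₂ <;> set_option synthInstance.maxSize 1000 in decide
    have h := eq_one_of_eq_one_of_cond_mul_cond_eq_one hxx₁ hxxx₂ hx he hex₂
    exact hpolya ⟨h.1, hx, h.2⟩
  · rintro -
    rw [isPolyaField_iff]
    -- By pigeonhole two bits agree, so some xᵢ is trivial and the other two classes coincide,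
    -- generating a group of order at most 2.
    have hbool : a₂ = a₃ ∨ a₁ = a₃ ∨ a₁ = a₂ := by
      clear * -
      revert a₁ a₂ a₃
      decide
    rcases hbool with ha | ha | ha
    · have h₁ := hax'.1 ha
      rw [h₁, one_mul] at hxxx
      refine Subgroup.eq_bot_or_nonempty_mulEquiv_of_le_zpowers hxx₂ (hle _ ?_ ?_ ?_ ?_ ?_)
      · simp [h₁]
      · simp
      · simp [mul_left_cancel (hxxx.trans hxx₂.symm)]
      · simp [hy₁1]
      · simp [hy₂1]
    · have h₂ := hax'.2.1 ha
      rw [h₂, mul_one] at hxxx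
      refine Subgroup.eq_bot_or_nonempty_mulEquiv_of_le_zpowers hxx₁ (hle _ ?_ ?_ ?_ ?_ ?_)
      · simp
      · simp [h₂]
      · simp [mul_left_cancel (hxxx.trans hxx₁.symm)]
      · simp [hy₁1]
      · simp [hy₂1]
    · have h₃ := hax'.2.2 ha
      rw [h₃, mul_one] at hxxx
      refine Subgroup.eq_bot_or_nonempty_mulEquiv_of_le_zpowers hxx₁ (hle _ ?_ ?_ ?_ ?_ ?_)
      · simp
      · simp [mul_left_cancel (hxxx.trans hxx₁.symm)]
      · simp [h₃]
      · simp [hy₁1]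
      · simp [hy₂1]
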